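/- Let $0<\mu<L$ and let $f:\mathbb R^d\to\mathbb R$ be continuously differentiable, $\mu$-strongly convex (i.e. $f-\frac{\mu}{2}\|\cdot\|^2$ is convex) and $L$-smooth (i.e. $\nabla f$ is $L$-Lipschitz), with minimum $f_*=\min f$. Fix $\alpha>0$, $\beta,\nu\ge 0$ and $x_0=x_{-1}\in\mathbb R^d$, and consider the noisy generalized momentum method $$x_{k+1}=x_k-\alpha\big(\nabla f(y_k)+w_{k+1}\big)+\beta(x_k-x_{k-1}),\qquad y_k=x_k+\nu(x_k-x_{k-1}),\qquad k\ge 0,$$ on a probability space. Let $\mathcal F_k$ be the $\sigma$-algebra generated by $x_0,\dots,x_k$, and assume that for all $k\ge0$ the random vector $w_{k+1}$ is $\mathcal F_{k+1}$-measurable and, for some $\sigma>0$, $$\mathbb P(\|w_{k+1}\|\ge s\mid\mathcal F_k)\le 2e^{-s^2/(2\sigma^2)}\quad\text{a.s., for all } s\ge 0$$ (the noise may be biased). Let $\rho_0,\rho_1,\rho_2,\rho_3\in[0,1)$, let $a,b,c_0,c_1\ge 0$ and let $\tilde P\in\mathbb R^{2\times2}$ be symmetric positive semidefinite. Put $\tilde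 r(\tilde P)=\tilde P_{11}-\tilde P_{12}^2/\tilde P_{22}$ if $\tilde P_{22}\ne0$ and $\tilde r(\tilde P)=\tilde P_{11}$ otherwise, and $$\delta=c_1+\tfrac2L\tilde r(\tilde P),\qquad \kappa=\max\{1,1/\delta\},\qquad r=a+\alpha^2\Big(\frac{c_1L}{2}+\tilde P_{11}\Big),$$ $$p=\rho_0^2+c_1\rho_1^2+\rho_2^2+\frac{4b(1+\nu)^2L^2}{\mu}c_1\kappa,\qquad q=\rho_3^2+\frac{4b\nu^2L^2}{\mu}c_1\kappa .$$ Assume that $p+q<1$, $\delta>0$, $c_1+\tilde P_{11}>0$, and that the $4\times4$ matrix inequality $\tilde M_2+c_1\tilde M_1+c_0\tilde M_0\succeq0$ holds. Here, with $\tilde\Delta=\beta-\nu$ and $$\tilde A=\begin{bmatrix}1+\beta&-\beta\\1&0\end{bmatrix},\quad \tilde B=\begin{bmatrix}-\alpha\\0\end{bmatrix},\quad \tilde C=\begin{bmatrix}1+\nu&-\nu\end{bmatrix},\quad \tilde M_3=\begin{bmatrix}1&-1\end{bmatrix},$$ the matrices are $$\tilde M_0=\begin{bmatrix}2\mu L\tilde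 C^\top\tilde C&-(\mu+L)\tilde C^\top&0\\-(\mu+L)\tilde C&2&0\\0&0&0\end{bmatrix},\qquad \tilde M_2=\begin{bmatrix}-\tilde A^\top\tilde P\tilde A+\rho_0^2\tilde P&-\tilde A^\top\tilde P\tilde B&-\tilde A^\top\tilde P\tilde B\\-\tilde B^\top\tilde P\tilde A&-\tilde B^\top\tilde P\tilde B+bc_1&-\tilde B^\top\tilde P\tilde B\\-\tilde B^\top\tilde P\tilde A&-\tilde B^\top\tilde P\tilde B&a\end{bmatrix},$$ $$\tilde M_1=\begin{bmatrix}\tilde X_1+\rho_0^2\tilde X_2+(1-\rho_0^2)\tilde X_3+\tilde Z&m\\m^\top&0\end{bmatrix},\qquad m=\begin{bmatrix}\frac{L\alpha(\beta-\nu)}{2}\tilde M_3^\top\\[2pt]\frac{\alpha(1-L\alpha)}{2}\end{bmatrix},$$ $$\tilde X_1=\frac12\begin{bmatrix}-L\tilde\Delta^2&L\tilde\Delta^2&-(1-\alpha L)\tilde\Delta\\L\tilde\Delta^2&-L\tilde\Delta^2&(1-\alpha L)\tilde\Delta\\-(1-\alpha L)\tilde\Delta&(1-\alpha L)\tilde\Delta&\alpha(2-L\alpha)\end{bmatrix},\quad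 \tilde X_2=\frac12\begin{bmatrix}\nu^2\mu&-\nu^2\mu&-\nu\\-\nu^2\mu&\nu^2\mu&\nu\\-\nu&\nu&0\end{bmatrix},$$ $$\tilde X_3=\frac12\begin{bmatrix}(1+\nu)^2\mu&-\nu(1+\nu)\mu&-(1+\nu)\\-\nu(1+\nu)\mu&\nu^2\mu&\nu\\-(1+\nu)&\nu&0\end{bmatrix},\quad \tilde Z=\begin{bmatrix}\rho_1^2\tilde P_{11}+\frac\mu2\rho_2^2&\rho_1^2\tilde P_{12}&0\\\rho_1^2\tilde P_{12}&\rho_1^2\tilde P_{22}+\frac\mu2\rho_3^2&0\\0&0&0\end{bmatrix}.$$ Set $$\overline H_\infty=\left(\frac{1}{1-(p+q)}\cdot\frac{r}{c_1+\frac2L\tilde r(\tilde P)}\right)^{1/2},\qquad \bar x_K=\frac{x_0+\dots+x_K}{K+1}.$$ Then for every $t\in\mathbb R$ (with $\log 0=-\infty$) $$\limsup_{K\to\infty}\frac1K\log\mathbb P\big(f(\bar x_K)-f_*\ge t\big)\le-\bar I(t),$$ where $$\bar I(t)=\begin{cases}\dfrac{t}{2\sigma^2\overline H_\infty^2}\sqrt{1-\dfrac{4\sigma^2\overline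 H_\infty^2}{t}}-\log\left(\dfrac{1+\sqrt{1-4\sigma^2\overline H_\infty^2/t}}{1-\sqrt{1-4\sigma^2\overline H_\infty^2/t}}\right),&t\ge4\sigma^2\overline H_\infty^2,\\[6pt]0,&t<4\sigma^2\overline H_\infty^2.\end{cases}$$ -/

import Mathlib

open scoped BigOperators ENNReal Matrix MeasureTheory

noncomputable section

namespace GMM

/-- The class `C_μ^L(E)`: continuously differentiable functions that are `μ`-strongly convex and
whose gradient is `L`-Lipschitz. -/
structure SmoothStronglyConvex {E : Type*} [NormedAddCommGroup E] [InnerProductSpace ℝ E]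
    [CompleteSpace E] (μ L : ℝ) (f : E → ℝ) : Prop where
  convex : ConvexOn ℝ Set.univ (fun x => f x - 1 / 2 * μ * ‖x‖ ^ 2)
  contDiff : ContDiff ℝ 1 f
  lipschitz : ∀ x y : E, ‖gradient f x - gradient f y‖ ≤ L * ‖x - y‖

section Iterates

variable {E : Type*} [NormedAddCommGroup E] [InnerProductSpace ℝ E] [CompleteSpace E]

/-- The state `(x_k, x_{k-1})` of the generalized momentum method driven by the gradient noise
sequence `w` (the noise used at step `k` is `w (k + 1)`), started from `x_0 = x_{-1} = x₀`. -/
def state (f : E → ℝ) (α β ν : ℝ) (x₀ : E) (w : ℕ → E) : ℕ → E × E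
  | 0 => (x₀, x₀)
  | k + 1 =>
    let x := (state f α β ν x₀ w k).1
    let x' := (state f α β ν x₀ w k).2
    let y := x + ν • (x - x')
    (x - α • (gradient f y + w (k + 1)) + β • (x - x'), x)

/-- The iterate `x_k`. -/
def iterate (f : E → ℝ) (α β ν : ℝ) (x₀ : E) (w : ℕ → E) (k : ℕ) : E :=
  (state f α β ν x₀ w k).1

/-- The averaged iterate `(x_0 + ⋯ + x_K) / (K + 1)`. -/
def average (f : E → ℝ) (α β ν : ℝ) (x₀ : E) (w : ℕ → E) (K : ℕ) : E :=
  ((K : ℝ) + 1)⁻¹ • ∑ k ∈ Finset.range (K + 1), iterate f α β ν x₀ w k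

/-- The σ-algebra generated by the random iterates `x_0, …, x_k`. -/
abbrev iterateSigma {Ω : Type*} [MeasurableSpace E] (f : E → ℝ) (α β ν : ℝ) (x₀ : E)
    (w : ℕ → Ω → E) (k : ℕ) : MeasurableSpace Ω :=
  ⨆ j ∈ Finset.range (k + 1),
    MeasurableSpace.comap (fun ω => iterate f α β ν x₀ (fun i => w i ω) j) inferInstance

end Iterates

/-- `w` is adapted to the σ-algebras generated by the iterates, and, conditionally on the past
iterates, the norm of each noise vector has a sub-Gaussian tail with variance proxy `σ²`. No
centering is required. -/
structure SubGaussianNoise {E : Type*} [NormedAddCommGroup E] [InnerProductSpace ℝ E]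
    [CompleteSpace E] [MeasurableSpace E] {Ω : Type*} [MeasurableSpace Ω]
    (P : MeasureTheory.Measure Ω) (f : E → ℝ) (α β ν : ℝ) (x₀ : E) (σ : ℝ)
    (w : ℕ → Ω → E) : Prop where
  measurable : ∀ k, Measurable (w (k + 1))
  adapted : ∀ k, Measurable[iterateSigma f α β ν x₀ w (k + 1)] (w (k + 1))
  tail : ∀ k, ∀ s : ℝ, 0 ≤ s →
    ∀ᵐ ω ∂P, MeasureTheory.condExp (iterateSigma f α β ν x₀ w k) P
      (Set.indicator {ω' | s ≤ ‖w (k + 1) ω'‖} (fun _ => (1 : ℝ))) ω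
        ≤ 2 * Real.exp (-(s ^ 2 / (2 * σ ^ 2)))

section Certificate

/-! In all matrices below, rows and columns are numbered from `0`. -/

def matA (β : ℝ) : Matrix (Fin 2) (Fin 2) ℝ := !![1 + β, -β; 1, 0]

def matB (α : ℝ) : Matrix (Fin 2) (Fin 1) ℝ := !![-α; 0]

def matC (ν : ℝ) : Matrix (Fin 1) (Fin 2) ℝ := !![1 + ν, -ν]

/-- The Schur complement `P₁₁ - P₁₂² / P₂₂`, or `P₁₁` if `P₂₂ = 0`. -/
def rTilde (P : Matrix (Fin 2) (Fin 2) ℝ) : ℝ :=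
  if P 1 1 ≠ 0 then P 0 0 - P 0 1 ^ 2 / P 1 1 else P 0 0

def matM0 (μ L ν : ℝ) : Matrix (Fin 4) (Fin 4) ℝ :=
  let C := matC ν
  let CC := Cᵀ * C
  !![2 * μ * L * CC 0 0, 2 * μ * L * CC 0 1, -(μ + L) * C 0 0, 0;
     2 * μ * L * CC 1 0, 2 * μ * L * CC 1 1, -(μ + L) * C 0 1, 0;
     -(μ + L) * C 0 0, -(μ + L) * C 0 1, 2, 0;
     0, 0, 0, 0]

def matX1 (L α β ν : ℝ) : Matrix (Fin 3) (Fin 3) ℝ :=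
  let Δ := β - ν
  (1 / 2 : ℝ) •
    !![-L * Δ ^ 2, L * Δ ^ 2, -(1 - α * L) * Δ;
       L * Δ ^ 2, -L * Δ ^ 2, (1 - L * α) * Δ;
       -(1 - α * L) * Δ, (1 - L * α) * Δ, α * (2 - L * α)]

def matX2 (μ ν : ℝ) : Matrix (Fin 3) (Fin 3) ℝ :=
  (1 / 2 : ℝ) •
    !![ν ^ 2 * μ, -ν ^ 2 * μ, -ν;
       -ν ^ 2 * μ, ν ^ 2 * μ, ν;
       -ν, ν, 0]

def matX3 (μ ν : ℝ) : Matrix (Fin 3) (Fin 3) ℝ :=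
  (1 / 2 : ℝ) •
    !![(1 + ν) ^ 2 * μ, -ν * (1 + ν) * μ, -(1 + ν);
       -ν * (1 + ν) * μ, ν ^ 2 * μ, ν;
       -(1 + ν), ν, 0]

def matZ (μ ρ₁ ρ₂ ρ₃ : ℝ) (P : Matrix (Fin 2) (Fin 2) ℝ) : Matrix (Fin 3) (Fin 3) ℝ :=
  !![ρ₁ ^ 2 * P 0 0 + μ / 2 * ρ₂ ^ 2, ρ₁ ^ 2 * P 0 1, 0;
     ρ₁ ^ 2 * P 0 1, ρ₁ ^ 2 * P 1 1 + μ / 2 * ρ₃ ^ 2, 0;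
     0, 0, 0]

def matM1 (μ L α β ν ρ₀ ρ₁ ρ₂ ρ₃ : ℝ) (P : Matrix (Fin 2) (Fin 2) ℝ) :
    Matrix (Fin 4) (Fin 4) ℝ :=
  let Y := matX1 L α β ν + ρ₀ ^ 2 • matX2 μ ν + (1 - ρ₀ ^ 2) • matX3 μ ν + matZ μ ρ₁ ρ₂ ρ₃ P
  let g := L * α * (β - ν) / 2
  let h := α * (1 - L * α) / 2
  !![Y 0 0, Y 0 1, Y 0 2, g;
     Y 1 0, Y 1 1, Y 1 2, -g;
     Y 2 0, Y 2 1, Y 2 2, h;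
     g, -g, h, 0]

def matM2 (α β ρ₀ a b c₁ : ℝ) (P : Matrix (Fin 2) (Fin 2) ℝ) : Matrix (Fin 4) (Fin 4) ℝ :=
  let A := matA β
  let B := matB α
  let U := -(Aᵀ * P * A) + ρ₀ ^ 2 • P
  let V := -(Aᵀ * P * B)
  let V' := -(Bᵀ * P * A)
  let W := -(Bᵀ * P * B)
  !![U 0 0, U 0 1, V 0 0, V 0 0;
     U 1 0, U 1 1, V 1 0, V 1 0;
     V' 0 0, V' 0 1, W 0 0 + b * c₁, W 0 0;
     V' 0 0, V' 0 1, W 0 0, a]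

/-- The factor `c₁ + (2 / L) r̃(P)` by which the Lyapunov function dominates the suboptimality. -/
def lyapFactor (L c₁ : ℝ) (P : Matrix (Fin 2) (Fin 2) ℝ) : ℝ := c₁ + 2 / L * rTilde P

/-- The normalization `max {1, 1 / (c₁ + (2 / L) r̃(P))}`; it equals `1` when
`c₁ + (2 / L) r̃(P) ≥ 1`. -/
def normFactor (L c₁ : ℝ) (P : Matrix (Fin 2) (Fin 2) ℝ) : ℝ := max 1 (1 / lyapFactor L c₁ P)

def coeffP (μ L ν ρ₀ ρ₁ ρ₂ b c₁ : ℝ) (P : Matrix (Fin 2) (Fin 2) ℝ) : ℝ :=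
  ρ₀ ^ 2 + c₁ * ρ₁ ^ 2 + ρ₂ ^ 2 + 4 * b * (1 + ν) ^ 2 * L ^ 2 / μ * c₁ * normFactor L c₁ P

def coeffQ (μ L ν ρ₃ b c₁ : ℝ) (P : Matrix (Fin 2) (Fin 2) ℝ) : ℝ :=
  ρ₃ ^ 2 + 4 * b * ν ^ 2 * L ^ 2 / μ * c₁ * normFactor L c₁ P

def coeffR (L α a c₁ : ℝ) (P : Matrix (Fin 2) (Fin 2) ℝ) : ℝ :=
  a + α ^ 2 * (c₁ * L / 2 + P 0 0)

/-- The bound `H̄_∞ = (r / ((1 - (p + q)) (c₁ + (2 / L) r̃(P))))^{1/2}`. -/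
def hBar (μ L α ν ρ₀ ρ₁ ρ₂ ρ₃ a b c₁ : ℝ) (P : Matrix (Fin 2) (Fin 2) ℝ) : ℝ :=
  Real.sqrt (1 / (1 - (coeffP μ L ν ρ₀ ρ₁ ρ₂ b c₁ P + coeffQ μ L ν ρ₃ b c₁ P)) *
    (coeffR L α a c₁ P / lyapFactor L c₁ P))

/-- The premise on the scalars `ρ_i, a, b, c₀, c₁` and on the `2 × 2` matrix `P`. -/
structure IsCertificate (μ L α β ν ρ₀ ρ₁ ρ₂ ρ₃ a b c₀ c₁ : ℝ)
    (P : Matrix (Fin 2) (Fin 2) ℝ) : Prop where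
  rho0_mem : ρ₀ ∈ Set.Ico (0 : ℝ) 1
  rho1_mem : ρ₁ ∈ Set.Ico (0 : ℝ) 1
  rho2_mem : ρ₂ ∈ Set.Ico (0 : ℝ) 1
  rho3_mem : ρ₃ ∈ Set.Ico (0 : ℝ) 1
  a_nonneg : 0 ≤ a
  b_nonneg : 0 ≤ b
  c0_nonneg : 0 ≤ c₀
  c1_nonneg : 0 ≤ c₁
  posSemidef : P.PosSemidef
  contraction : coeffP μ L ν ρ₀ ρ₁ ρ₂ b c₁ P + coeffQ μ L ν ρ₃ b c₁ P < 1
  lyapFactor_pos : 0 < lyapFactor L c₁ P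
  c1_add_pos : 0 < c₁ + P 0 0
  matrixInequality :
    (matM2 α β ρ₀ a b c₁ P + c₁ • matM1 μ L α β ν ρ₀ ρ₁ ρ₂ ρ₃ P + c₀ • matM0 μ L ν).PosSemidef

end Certificate

/-- The rate function `Ī(t)`, as a function of `σ`, `H = H̄_∞` and `t`. -/
def rate (σ H t : ℝ) : ℝ :=
  if 4 * σ ^ 2 * H ^ 2 ≤ t then
    t / (2 * σ ^ 2 * H ^ 2) * Real.sqrt (1 - 4 * σ ^ 2 * H ^ 2 / t)
      - Real.log ((1 + Real.sqrt (1 - 4 * σ ^ 2 * H ^ 2 / t))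
          / (1 - Real.sqrt (1 - 4 * σ ^ 2 * H ^ 2 / t)))
  else 0

end GMM

end

/-!
The matrix inequality certifies that `V = c₁ (f - f z) + (x - z, x' - z)ᵀ P (x - z, x' - z)`, with
`z` the minimizer of `f`, is a Lyapunov function. A positive semidefinite matrix has nonnegative Gram
form at vectors of any inner product space (`gram_nonneg`); at the vectors `x - z`, `x' - z`, `∇f(y)`
and the noise `w`, this form combines the descent lemma at `y`, the first-order strong convexity
bounds from `y` to `x` and to `z`, and the interpolation inequality between `y` and `z`. The result is
the pathwise recursion `V_{k+1} ≤ p V_k + q V_{k-1} + r ‖w_{k+1}‖²` (`lyap_step`), in which no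
conditional expectation is taken, so that the noise need not be centred.

Since `V` dominates the suboptimality up to the factor `c₁ + (2 / L) r̃(P)`, summing the recursion and
applying Jensen's inequality gives
`(K + 1) (f(x̄_K) - f z) ≤ C + H̄_∞² ∑_{k ≤ K} ‖w_k‖²` (`average_suboptimality_le`).

The sub-Gaussian tails give, for `0 ≤ l < 1`, the conditional moment bound
`E[exp (l ‖w_{k+1}‖² / (2 σ²)) | F_k] ≤ (1 + l) / (1 - l)`, which is iterated over `k`
(`lintegral_exp_sum_sq_le`). Markov's inequality then bounds the exponential decay rate by
`log ((1 + l) / (1 - l)) - l t / (2 σ² H̄_∞²)`; when `t ≥ 4 σ² H̄_∞²` this is minimized at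
`l = √(1 - 4 σ² H̄_∞² / t)`, where it equals `-Ī(t)`. For smaller `t`, where `Ī(t) = 0`, the bound is
the triviality that a probability is at most `1`.
-/

noncomputable section

namespace GMM

/-! ### Smooth strongly convex functions -/

section Convex

variable {E : Type*} [NormedAddCommGroup E] [InnerProductSpace ℝ E] [CompleteSpace E]
variable {μ L : ℝ} {f : E → ℝ}

namespace SmoothStronglyConvex

theorem hasDerivAt_line (hf : SmoothStronglyConvex μ L f) (x d : E) (t : ℝ) :
    HasDerivAt (fun s : ℝ => f (x + s • d)) (inner ℝ (gradient f (x + t • d)) d) t := by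
  have h1 : HasGradientAt f (gradient f (x + t • d)) (x + t • d) :=
    (hf.contDiff.differentiable one_ne_zero _).hasGradientAt
  have h2 : HasDerivAt (fun s : ℝ => x + s • d) d t := by
    simpa using ((hasDerivAt_id t).smul_const d).const_add x
  have h3 := h1.hasFDerivAt.comp_hasDerivAt t h2
  rw [InnerProductSpace.toDual_apply_apply] at h3
  exact h3

/-- First-order form of strong convexity. -/
theorem lower_bound (hf : SmoothStronglyConvex μ L f) (x y : E) :
    f x + inner ℝ (gradient f x) (y - x) + μ / 2 * ‖y - x‖ ^ 2 ≤ f y := by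
  set d := y - x with hd
  have hnorm : ∀ s : ℝ, ‖x + s • d‖ ^ 2 = ‖x‖ ^ 2 + s * (2 * inner ℝ x d) + s ^ 2 * ‖d‖ ^ 2 := by
    intro s
    rw [norm_add_sq_real, real_inner_smul_right, norm_smul, mul_pow, Real.norm_eq_abs, sq_abs]
    ring
  have hconv : ConvexOn ℝ Set.univ
      (fun s : ℝ => f (x + s • d) - 1 / 2 * μ * ‖x + s • d‖ ^ 2) := by
    refine ⟨convex_univ, fun a _ b _ u v hu hv huv => ?_⟩
    have key := hf.convex.2 (Set.mem_univ (x + a • d)) (Set.mem_univ (x + b • d)) hu hv huv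
    have hpt : u • (x + a • d) + v • (x + b • d) = x + (u • a + v • b) • d := by
      have hx : x = (u + v) • x := by rw [huv, one_smul]
      conv_rhs => rw [hx]
      simp only [smul_eq_mul]
      module
    rwa [hpt] at key
  have hder : HasDerivAt (fun s : ℝ => f (x + s • d) - 1 / 2 * μ * ‖x + s • d‖ ^ 2)
      (inner ℝ (gradient f x) d - 1 / 2 * μ * (2 * inner ℝ x d)) 0 := by
    have h1 := hf.hasDerivAt_line x d 0
    rw [zero_smul, add_zero] at h1
    refine h1.sub (HasDerivAt.const_mul _ ?_)
    simp only [hnorm]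
    have h2 := (((hasDerivAt_id (0 : ℝ)).mul_const (2 * inner ℝ x d)).const_add (‖x‖ ^ 2)).add
      ((hasDerivAt_pow 2 (0 : ℝ)).mul_const (‖d‖ ^ 2))
    refine h2.congr_deriv ?_
    norm_num
  have h := hconv.le_slope_of_hasDerivAt (Set.mem_univ 0) (Set.mem_univ 1) one_pos hder
  have h1 := hnorm 1
  simp only [slope_def_field, zero_smul, one_smul, add_zero] at h h1
  have hxy : x + d = y := by rw [hd]; abel
  rw [h1, hxy] at h
  linarith

/-- The descent lemma. -/
theorem upper_bound (hf : SmoothStronglyConvex μ L f) (x y : E) :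
    f y ≤ f x + inner ℝ (gradient f x) (y - x) + L / 2 * ‖y - x‖ ^ 2 := by
  set d := y - x with hd
  have hder : ∀ t : ℝ, HasDerivAt
      (fun s : ℝ => f (x + s • d) - s * inner ℝ (gradient f x) d - s ^ 2 * (L / 2 * ‖d‖ ^ 2))
      (inner ℝ (gradient f (x + t • d)) d - inner ℝ (gradient f x) d - t * (L * ‖d‖ ^ 2)) t := by
    intro t
    have h := ((hf.hasDerivAt_line x d t).sub
      ((hasDerivAt_id t).mul_const (inner ℝ (gradient f x) d))).sub
      ((hasDerivAt_pow 2 t).mul_const (L / 2 * ‖d‖ ^ 2))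
    refine h.congr_deriv ?_
    simp only [Nat.cast_ofNat, one_mul]
    ring
  have hanti : AntitoneOn
      (fun s : ℝ => f (x + s • d) - s * inner ℝ (gradient f x) d - s ^ 2 * (L / 2 * ‖d‖ ^ 2))
      (Set.Icc 0 1) := by
    refine antitoneOn_of_deriv_nonpos (convex_Icc 0 1)
      (fun t _ => (hder t).continuousAt.continuousWithinAt)
      (fun t _ => (hder t).differentiableAt.differentiableWithinAt) (fun t ht => ?_)
    rw [interior_Icc] at ht
    rw [(hder t).deriv, ← inner_sub_left]
    have h1 := real_inner_le_norm (gradient f (x + t • d) - gradient f x) d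
    have h2 := hf.lipschitz (x + t • d) x
    rw [add_sub_cancel_left, norm_smul, Real.norm_eq_abs, abs_of_pos ht.1] at h2
    have h3 := mul_le_mul_of_nonneg_right h2 (norm_nonneg d)
    nlinarith
  have h := hanti (Set.left_mem_Icc.2 zero_le_one) (Set.right_mem_Icc.2 zero_le_one) zero_le_one
  have hxy : x + d = y := by rw [hd]; abel
  simp only [one_smul, zero_smul, add_zero, hxy] at h
  linarith

/-- The convex part `f - μ/2 ‖·‖²` exceeds its linearization at `x` by at least the squared gradient
gap over `2 (L - μ)`. With the linearization removed this part is minimal at `x`, and one gradient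
step of length `1 / (L - μ)` from `y` decreases it by at least that amount. -/
theorem gradient_gap_le (hf : SmoothStronglyConvex μ L f) (hμL : μ < L) (x y : E) :
    f x + inner ℝ (gradient f x) (y - x) + μ / 2 * ‖y - x‖ ^ 2
      + 1 / (2 * (L - μ)) * ‖gradient f y - gradient f x - μ • (y - x)‖ ^ 2 ≤ f y := by
  have hM : 0 < L - μ := sub_pos.2 hμL
  set d := y - x with hd
  set G := gradient f y - gradient f x - μ • d with hG
  set c := (L - μ)⁻¹ with hc
  set z := y - c • G with hz
  have h1 := hf.lower_bound x z
  have h2 := hf.upper_bound y z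
  have hzx : z - x = d - c • G := by rw [hz, hd]; abel
  have hzy : z - y = -(c • G) := by rw [hz]; abel
  rw [hzx, inner_sub_right, real_inner_smul_right, norm_sub_sq_real, real_inner_smul_right,
    norm_smul, mul_pow, Real.norm_eq_abs, sq_abs] at h1
  rw [hzy, inner_neg_right, real_inner_smul_right, norm_neg, norm_smul, mul_pow,
    Real.norm_eq_abs, sq_abs] at h2
  have h3 : ‖G‖ ^ 2 = inner ℝ (gradient f y) G - inner ℝ (gradient f x) G - μ * inner ℝ d G := by
    rw [← real_inner_self_eq_norm_sq]
    conv_lhs => rw [hG, inner_sub_left, inner_sub_left, real_inner_smul_left]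
  have h4 : 1 / (2 * (L - μ)) = c / 2 := by rw [hc]; field_simp
  have h5 : c ^ 2 * (L - μ) = c := by rw [hc]; field_simp
  have h6 : c * ‖G‖ ^ 2
      = c * (inner ℝ (gradient f y) G - inner ℝ (gradient f x) G - μ * inner ℝ d G) := by rw [h3]
  have h7 : c ^ 2 * (L - μ) * ‖G‖ ^ 2 = c * ‖G‖ ^ 2 := by rw [h5]
  rw [h4]
  linarith

/-- The interpolation inequality of strongly convex smooth functions. -/
theorem interpolation (hf : SmoothStronglyConvex μ L f) (hμL : μ < L) (x y : E) :
    μ * L * ‖y - x‖ ^ 2 + ‖gradient f y - gradient f x‖ ^ 2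
      ≤ (μ + L) * inner ℝ (gradient f y - gradient f x) (y - x) := by
  have hM : 0 < L - μ := sub_pos.2 hμL
  have h1 := hf.gradient_gap_le hμL x y
  have h2 := hf.gradient_gap_le hμL y x
  have hG : gradient f x - gradient f y - μ • (x - y)
      = -(gradient f y - gradient f x - μ • (y - x)) := by module
  have hn : x - y = -(y - x) := by abel
  rw [hG, norm_neg, hn, norm_neg, inner_neg_right] at h2
  set d := y - x
  have hnorm : ‖gradient f y - gradient f x - μ • d‖ ^ 2 = ‖gradient f y - gradient f x‖ ^ 2
      - 2 * (μ * (inner ℝ (gradient f y) d - inner ℝ (gradient f x) d)) + μ ^ 2 * ‖d‖ ^ 2 := by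
    rw [norm_sub_sq_real (gradient f y - gradient f x), norm_smul, real_inner_smul_right, mul_pow,
      Real.norm_eq_abs, sq_abs, inner_sub_left]
  rw [hnorm] at h1 h2
  rw [inner_sub_left]
  have hk : 2 * (L - μ) * (1 / (2 * (L - μ))) = 1 := by field_simp
  have h3 := mul_le_mul_of_nonneg_left (add_le_add h1 h2) hM.le
  set c := 1 / (2 * (L - μ))
  set S := ‖gradient f y - gradient f x‖ ^ 2 - 2 * (μ * (inner ℝ (gradient f y) d
    - inner ℝ (gradient f x) d)) + μ ^ 2 * ‖d‖ ^ 2 with hS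
  have h4 : 2 * (L - μ) * c * S = S := by rw [hk, one_mul]
  nlinarith

theorem exists_minimizer [FiniteDimensional ℝ E] (hf : SmoothStronglyConvex μ L f) (hμ : 0 < μ) :
    ∃ z : E, ∀ x, f z ≤ f x := by
  refine hf.contDiff.continuous.exists_forall_le ?_
  have h : ∀ x : E, f 0 + ‖x‖ * (μ / 2 * ‖x‖ - ‖gradient f 0‖) ≤ f x := by
    intro x
    have h1 := hf.lower_bound 0 x
    rw [sub_zero] at h1
    have h2 := neg_le_of_abs_le (abs_real_inner_le_norm (gradient f 0) x)
    nlinarith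
  refine Filter.tendsto_atTop_mono h (Filter.tendsto_atTop_add_const_left _ _ ?_)
  have hn : Filter.Tendsto (fun x : E => ‖x‖) (Filter.cocompact E) Filter.atTop :=
    tendsto_norm_cocompact_atTop
  exact hn.atTop_mul_atTop₀
    (Filter.tendsto_atTop_add_const_right _ _ (hn.const_mul_atTop (half_pos hμ)))

theorem gradient_eq_zero {z : E} (hz : ∀ x, f z ≤ f x) : gradient f z = 0 := by
  rw [gradient, IsLocalMin.fderiv_eq_zero (Filter.Eventually.of_forall hz), map_zero]

theorem convexOn (hf : SmoothStronglyConvex μ L f) (hμ : 0 < μ) : ConvexOn ℝ Set.univ f := by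
  have h : ConvexOn ℝ Set.univ (fun x : E => 1 / 2 * μ * ‖x‖ ^ 2) :=
    (((convexOn_norm convex_univ).pow (fun _ _ => norm_nonneg _) 2).smul
      (show (0 : ℝ) ≤ 1 / 2 * μ by positivity))
  exact (hf.convex.add h).congr fun x _ => by simp

end SmoothStronglyConvex
end Convex

/-! ### The Lyapunov inequality -/

section Lyapunov

variable {E : Type*} [NormedAddCommGroup E] [InnerProductSpace ℝ E]

/-- A positive semidefinite matrix is a sum of rank-one matrices `v vᵀ`, and each of these turns the
Gram form into a squared norm. -/
theorem gram_nonneg {n : Type*} [Fintype n] {M : Matrix n n ℝ} (hM : M.PosSemidef) (v : n → E) :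
    0 ≤ ∑ i, ∑ j, M i j * inner ℝ (v i) (v j) := by
  obtain ⟨m, u, rfl⟩ := Matrix.posSemidef_iff_eq_sum_vecMulVec.1 hM
  have h : ∑ i, ∑ j, (∑ k : Fin m, Matrix.vecMulVec (u k) (star (u k))) i j * inner ℝ (v i) (v j)
      = ∑ k, ‖∑ i, u k i • v i‖ ^ 2 := by
    calc _ = ∑ i, ∑ j, ∑ k, u k i * u k j * inner ℝ (v i) (v j) := by
          simp only [Matrix.sum_apply, Matrix.vecMulVec_apply, star_trivial, Finset.sum_mul]
      _ = ∑ i, ∑ k, ∑ j, u k i * u k j * inner ℝ (v i) (v j) :=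
          Finset.sum_congr rfl fun i _ => Finset.sum_comm
      _ = ∑ k, ∑ i, ∑ j, u k i * u k j * inner ℝ (v i) (v j) := Finset.sum_comm
      _ = _ := by
          simp only [← real_inner_self_eq_norm_sq, sum_inner, inner_sum, real_inner_smul_left,
            real_inner_smul_right, mul_assoc]
          exact Finset.sum_congr rfl fun k _ => Finset.sum_congr rfl fun i _ =>
            Finset.sum_congr rfl fun j _ => by rw [real_inner_comm]
  rw [h]
  positivity

/-- The quadratic form of `P ⊗ I` at the pair `(u, v)`, for symmetric `P`. -/
def pairForm (P : Matrix (Fin 2) (Fin 2) ℝ) (u v : E) : ℝ :=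
  P 0 0 * ‖u‖ ^ 2 + 2 * P 0 1 * inner ℝ u v + P 1 1 * ‖v‖ ^ 2

/-- The Lyapunov function `c₁ (f x - f z) + (x - z, x' - z)ᵀ P (x - z, x' - z)` at the state
`(x, x')`, where `z` stands for the minimizer of `f`. -/
def lyap (f : E → ℝ) (c₁ : ℝ) (P : Matrix (Fin 2) (Fin 2) ℝ) (z x x' : E) : ℝ :=
  c₁ * (f x - f z) + pairForm P (x - z) (x' - z)

section PairForm

variable {P : Matrix (Fin 2) (Fin 2) ℝ}

theorem symm_apply (hP : P.PosSemidef) : P 1 0 = P 0 1 := by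
  simpa using hP.isHermitian.apply 0 1

theorem sq_le_mul (hP : P.PosSemidef) : P 0 1 ^ 2 ≤ P 0 0 * P 1 1 := by
  have h := hP.det_nonneg
  rw [Matrix.det_fin_two, symm_apply hP] at h
  linarith

theorem rTilde_nonneg (hP : P.PosSemidef) : 0 ≤ rTilde P := by
  unfold rTilde
  split_ifs with h
  · have h1 : 0 < P 1 1 := lt_of_le_of_ne hP.diag_nonneg (Ne.symm h)
    rw [sub_nonneg, div_le_iff₀ h1]
    exact sq_le_mul hP
  · exact hP.diag_nonneg

/-- Minimizing the form over its second argument leaves the Schur complement. -/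
theorem rTilde_mul_le_pairForm (hP : P.PosSemidef) (u v : E) :
    rTilde P * ‖u‖ ^ 2 ≤ pairForm P u v := by
  unfold rTilde pairForm
  split_ifs with h
  · have h1 : 0 < P 1 1 := lt_of_le_of_ne hP.diag_nonneg (Ne.symm h)
    have h2 : 0 ≤ P 1 1 * ‖v + (P 0 1 / P 1 1) • u‖ ^ 2 := by positivity
    rw [norm_add_sq_real, norm_smul, real_inner_smul_right, mul_pow, Real.norm_eq_abs, sq_abs,
      real_inner_comm] at h2
    have h3 : P 1 1 * (‖v‖ ^ 2 + 2 * (P 0 1 / P 1 1 * inner ℝ u v)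
        + (P 0 1 / P 1 1) ^ 2 * ‖u‖ ^ 2) = P 1 1 * ‖v‖ ^ 2 + 2 * P 0 1 * inner ℝ u v
        + P 0 1 ^ 2 / P 1 1 * ‖u‖ ^ 2 := by field_simp
    linarith
  · have h1 : P 1 1 = 0 := not_not.1 h
    have h2 := sq_le_mul hP
    rw [h1, mul_zero] at h2
    have h3 : P 0 1 = 0 := by nlinarith
    simp [h1, h3]

theorem pairForm_nonneg (hP : P.PosSemidef) (u v : E) : 0 ≤ pairForm P u v :=
  (mul_nonneg (rTilde_nonneg hP) (sq_nonneg _)).trans (rTilde_mul_le_pairForm hP u v)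

end PairForm

variable {μ L α β ν ρ₀ ρ₁ ρ₂ ρ₃ a b c₀ c₁ : ℝ} {P : Matrix (Fin 2) (Fin 2) ℝ}

/-- The Gram form of the certificate matrix, written as the terms of the one-step estimate it
encodes: `e`, `e'` are the last two displacements from the minimizer, `g` the gradient at the
extrapolated point and `w` the noise. -/
theorem certificate_form_nonneg (hP : P.PosSemidef)
    (hM : (matM2 α β ρ₀ a b c₁ P + c₁ • matM1 μ L α β ν ρ₀ ρ₁ ρ₂ ρ₃ P
      + c₀ • matM0 μ L ν).PosSemidef) (e e' g w : E) :
    0 ≤ -pairForm P ((1 + β) • e - β • e' - α • (g + w)) e + ρ₀ ^ 2 * pairForm P e e'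
      + b * c₁ * ‖g‖ ^ 2 + coeffR L α a c₁ P * ‖w‖ ^ 2
      - c₁ * (inner ℝ g ((β - ν) • (e - e') - α • (g + w))
          + L / 2 * ‖(β - ν) • (e - e') - α • (g + w)‖ ^ 2)
      - c₁ * ρ₀ ^ 2 * (inner ℝ g (ν • (e - e')) - μ / 2 * ‖ν • (e - e')‖ ^ 2)
      - c₁ * (1 - ρ₀ ^ 2) * (inner ℝ g (e + ν • (e - e')) - μ / 2 * ‖e + ν • (e - e')‖ ^ 2)
      + c₁ * (ρ₁ ^ 2 * pairForm P e e' + μ / 2 * (ρ₂ ^ 2 * ‖e‖ ^ 2 + ρ₃ ^ 2 * ‖e'‖ ^ 2))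
      + 2 * c₀ * (μ * L * ‖e + ν • (e - e')‖ ^ 2 + ‖g‖ ^ 2
          - (μ + L) * inner ℝ g (e + ν • (e - e'))) := by
  have h := gram_nonneg hM ![e, e', g, w]
  refine h.trans_eq ?_
  have hs := symm_apply hP
  simp [Fin.sum_univ_four, matM2, matM1, matM0, matX1, matX2, matX3, matZ, matA, matB, matC,
    Matrix.mul_apply, Fin.sum_univ_two, hs]
  simp only [pairForm, coeffR, ← real_inner_self_eq_norm_sq, inner_add_left, inner_add_right,
    inner_sub_left, inner_sub_right, real_inner_smul_left, real_inner_smul_right]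
  rw [real_inner_comm e e', real_inner_comm e g, real_inner_comm e w, real_inner_comm e' g,
    real_inner_comm e' w, real_inner_comm g w]
  ring

section OneStep

variable {f : E → ℝ} {z : E}

theorem lyap_nonneg (hP : P.PosSemidef) (hc₁ : 0 ≤ c₁) (hz : ∀ x, f z ≤ f x) (x x' : E) :
    0 ≤ lyap f c₁ P z x x' :=
  add_nonneg (mul_nonneg hc₁ (sub_nonneg.2 (hz x))) (pairForm_nonneg hP _ _)

variable [CompleteSpace E]

theorem lyapFactor_mul_le_lyap (hf : SmoothStronglyConvex μ L f) (hL : 0 < L)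
    (hP : P.PosSemidef) (hz : ∀ x, f z ≤ f x) (x x' : E) :
    lyapFactor L c₁ P * (f x - f z) ≤ lyap f c₁ P z x x' := by
  have h1 := hf.upper_bound z x
  rw [SmoothStronglyConvex.gradient_eq_zero hz, inner_zero_left] at h1
  have h2 : 2 / L * (f x - f z) ≤ ‖x - z‖ ^ 2 := by
    rw [div_mul_eq_mul_div, div_le_iff₀ hL]
    linarith
  have h3 := mul_le_mul_of_nonneg_left h2 (rTilde_nonneg hP)
  have h4 := rTilde_mul_le_pairForm hP (x - z) (x' - z)
  unfold lyapFactor lyap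
  linarith

theorem suboptimality_le_normFactor_mul_lyap (hf : SmoothStronglyConvex μ L f) (hL : 0 < L)
    (hP : P.PosSemidef) (hc₁ : 0 ≤ c₁) (hδ : 0 < lyapFactor L c₁ P) (hz : ∀ x, f z ≤ f x)
    (x x' : E) : f x - f z ≤ normFactor L c₁ P * lyap f c₁ P z x x' := by
  have h1 := lyapFactor_mul_le_lyap (c₁ := c₁) hf hL hP hz x x'
  calc f x - f z ≤ 1 / lyapFactor L c₁ P * lyap f c₁ P z x x' := by
        rw [one_div_mul_eq_div, le_div_iff₀ hδ]
        linarith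
    _ ≤ _ := mul_le_mul_of_nonneg_right (le_max_right _ _) (lyap_nonneg hP hc₁ hz x x')

/-- One step of the method before the current and previous distances and the gradient are absorbed
into the Lyapunov function: the descent lemma at `y`, the strong convexity bounds from `y` to `x`
and to `z`, and the interpolation inequality, combined with the weights of the certificate. -/
theorem lyap_step_aux (hf : SmoothStronglyConvex μ L f) (hμL : μ < L) (hz : ∀ x, f z ≤ f x)
    (hP : IsCertificate μ L α β ν ρ₀ ρ₁ ρ₂ ρ₃ a b c₀ c₁ P) (x x' y w : E)
    (hy : y = x + ν • (x - x')) :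
    lyap f c₁ P z (x - α • (gradient f y + w) + β • (x - x')) x
      ≤ ρ₀ ^ 2 * lyap f c₁ P z x x'
        + c₁ * (ρ₁ ^ 2 * pairForm P (x - z) (x' - z)
          + μ / 2 * (ρ₂ ^ 2 * ‖x - z‖ ^ 2 + ρ₃ ^ 2 * ‖x' - z‖ ^ 2))
        + b * c₁ * ‖gradient f y‖ ^ 2 + coeffR L α a c₁ P * ‖w‖ ^ 2 := by
  set g := gradient f y with hg
  set X := x - α • (g + w) + β • (x - x') with hX
  have hform := certificate_form_nonneg hP.posSemidef hP.matrixInequality (x - z) (x' - z) g w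
  have e1 : (1 + β) • (x - z) - β • (x' - z) - α • (g + w) = X - z := by rw [hX]; module
  have e2 : (β - ν) • (x - z - (x' - z)) - α • (g + w) = X - y := by rw [hX, hy]; module
  have e3 : ν • (x - z - (x' - z)) = y - x := by rw [hy]; module
  have e4 : x - z + (y - x) = y - z := by abel
  rw [e1, e2, e3, e4] at hform
  have h1 := hf.upper_bound y X
  have h2 := hf.lower_bound y x
  have h3 := hf.lower_bound y z
  have h4 := hf.interpolation hμL z y
  rw [SmoothStronglyConvex.gradient_eq_zero hz, sub_zero] at h4
  rw [← hg] at h1 h2 h3 h4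
  rw [← neg_sub y x, inner_neg_right, norm_neg] at h2
  rw [← neg_sub y z, inner_neg_right, norm_neg] at h3
  have hρ : 0 ≤ 1 - ρ₀ ^ 2 := by
    have := hP.rho0_mem.1
    have := hP.rho0_mem.2
    nlinarith
  have k1 := mul_le_mul_of_nonneg_left h1 hP.c1_nonneg
  have k2 := mul_le_mul_of_nonneg_left h2 (mul_nonneg hP.c1_nonneg (sq_nonneg ρ₀))
  have k3 := mul_le_mul_of_nonneg_left h3 (mul_nonneg hP.c1_nonneg hρ)
  have k4 := mul_le_mul_of_nonneg_left h4 hP.c0_nonneg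
  unfold lyap
  linarith

theorem sq_dist_minimizer_le (hf : SmoothStronglyConvex μ L f) (hz : ∀ x, f z ≤ f x) (x : E) :
    μ / 2 * ‖x - z‖ ^ 2 ≤ f x - f z := by
  have h := hf.lower_bound z x
  rw [SmoothStronglyConvex.gradient_eq_zero hz, inner_zero_left] at h
  linarith

/-- The gradient at the extrapolated point is controlled by the last two suboptimalities. -/
theorem sq_norm_gradient_le (hf : SmoothStronglyConvex μ L f) (hμ : 0 < μ)
    (hz : ∀ x, f z ≤ f x) (x x' : E) :
    ‖gradient f (x + ν • (x - x'))‖ ^ 2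
      ≤ 4 * L ^ 2 / μ * ((1 + ν) ^ 2 * (f x - f z) + ν ^ 2 * (f x' - f z)) := by
  have h1 := hf.lipschitz (x + ν • (x - x')) z
  rw [SmoothStronglyConvex.gradient_eq_zero hz, sub_zero] at h1
  have h2 : ‖x + ν • (x - x') - z‖ ^ 2
      ≤ 2 * ((1 + ν) ^ 2 * ‖x - z‖ ^ 2 + ν ^ 2 * ‖x' - z‖ ^ 2) := by
    have e : x + ν • (x - x') - z = (1 + ν) • (x - z) - ν • (x' - z) := by module
    have p := parallelogram_law_with_norm ℝ ((1 + ν) • (x - z)) (ν • (x' - z))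
    have q := sq_nonneg ‖(1 + ν) • (x - z) + ν • (x' - z)‖
    have n1 : ‖(1 + ν) • (x - z)‖ ^ 2 = (1 + ν) ^ 2 * ‖x - z‖ ^ 2 := by
      rw [norm_smul, mul_pow, Real.norm_eq_abs, sq_abs]
    have n2 : ‖ν • (x' - z)‖ ^ 2 = ν ^ 2 * ‖x' - z‖ ^ 2 := by
      rw [norm_smul, mul_pow, Real.norm_eq_abs, sq_abs]
    rw [e]
    linarith
  have hd : ∀ u : E, ‖u - z‖ ^ 2 ≤ 2 / μ * (f u - f z) := by
    intro u
    have := sq_dist_minimizer_le hf hz u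
    rw [div_mul_eq_mul_div, le_div_iff₀ hμ]
    linarith
  have h3 := mul_le_mul_of_nonneg_left (hd x) (sq_nonneg (1 + ν))
  have h4 := mul_le_mul_of_nonneg_left (hd x') (sq_nonneg ν)
  calc ‖gradient f (x + ν • (x - x'))‖ ^ 2 ≤ (L * ‖x + ν • (x - x') - z‖) ^ 2 :=
        pow_le_pow_left₀ (norm_nonneg _) h1 2
    _ = L ^ 2 * ‖x + ν • (x - x') - z‖ ^ 2 := mul_pow _ _ _
    _ ≤ L ^ 2 * (2 * ((1 + ν) ^ 2 * (2 / μ * (f x - f z)) + ν ^ 2 * (2 / μ * (f x' - f z)))) :=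
        mul_le_mul_of_nonneg_left (by linarith) (sq_nonneg L)
    _ = _ := by ring

/-- The Lyapunov recursion. The states `(x', x'')` and `(x, x')` need not be consecutive: only the
suboptimality of `x'` is bounded through `lyap f c₁ P z x' x''`, so `x''` is arbitrary. -/
theorem lyap_step (hf : SmoothStronglyConvex μ L f) (hμ : 0 < μ) (hμL : μ < L)
    (hz : ∀ x, f z ≤ f x) (hP : IsCertificate μ L α β ν ρ₀ ρ₁ ρ₂ ρ₃ a b c₀ c₁ P)
    (x x' x'' w : E) :
    lyap f c₁ P z (x - α • (gradient f (x + ν • (x - x')) + w) + β • (x - x')) x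
      ≤ coeffP μ L ν ρ₀ ρ₁ ρ₂ b c₁ P * lyap f c₁ P z x x'
        + coeffQ μ L ν ρ₃ b c₁ P * lyap f c₁ P z x' x'' + coeffR L α a c₁ P * ‖w‖ ^ 2 := by
  have hc₁ := hP.c1_nonneg
  have hb := hP.b_nonneg
  have hL : 0 < L := hμ.trans hμL
  have h := lyap_step_aux hf hμL hz hP x x' _ w rfl
  have hF := hz x
  have hF' := hz x'
  have p1 : c₁ * (f x - f z) ≤ lyap f c₁ P z x x' :=
    le_add_of_nonneg_right (pairForm_nonneg hP.posSemidef _ _)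
  have p2 : c₁ * (f x' - f z) ≤ lyap f c₁ P z x' x'' :=
    le_add_of_nonneg_right (pairForm_nonneg hP.posSemidef _ _)
  have p3 : pairForm P (x - z) (x' - z) ≤ lyap f c₁ P z x x' :=
    le_add_of_nonneg_left (mul_nonneg hc₁ (sub_nonneg.2 hF))
  have s1 := suboptimality_le_normFactor_mul_lyap hf hL hP.posSemidef hc₁ hP.lyapFactor_pos hz x x'
  have s2 :=
    suboptimality_le_normFactor_mul_lyap hf hL hP.posSemidef hc₁ hP.lyapFactor_pos hz x' x''
  have d1 := mul_le_mul_of_nonneg_left (sq_dist_minimizer_le hf hz x) hc₁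
  have d2 := mul_le_mul_of_nonneg_left (sq_dist_minimizer_le hf hz x') hc₁
  have k1 := mul_le_mul_of_nonneg_left p3 (mul_nonneg hc₁ (sq_nonneg ρ₁))
  have k2 := mul_le_mul_of_nonneg_left (d1.trans p1) (sq_nonneg ρ₂)
  have k3 := mul_le_mul_of_nonneg_left (d2.trans p2) (sq_nonneg ρ₃)
  have hg : b * c₁ * ‖gradient f (x + ν • (x - x'))‖ ^ 2
      ≤ b * c₁ * (4 * L ^ 2 / μ * ((1 + ν) ^ 2 * (normFactor L c₁ P * lyap f c₁ P z x x')
        + ν ^ 2 * (normFactor L c₁ P * lyap f c₁ P z x' x''))) := by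
    refine mul_le_mul_of_nonneg_left ((sq_norm_gradient_le hf hμ hz x x').trans ?_)
      (mul_nonneg hb hc₁)
    gcongr
  have e : b * c₁ * (4 * L ^ 2 / μ * ((1 + ν) ^ 2 * (normFactor L c₁ P * lyap f c₁ P z x x')
        + ν ^ 2 * (normFactor L c₁ P * lyap f c₁ P z x' x'')))
      = 4 * b * (1 + ν) ^ 2 * L ^ 2 / μ * c₁ * normFactor L c₁ P * lyap f c₁ P z x x'
        + 4 * b * ν ^ 2 * L ^ 2 / μ * c₁ * normFactor L c₁ P * lyap f c₁ P z x' x'' := by ring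
  rw [e] at hg
  unfold coeffP coeffQ
  linarith

end OneStep

/-! ### Accumulated suboptimality along a trajectory -/

theorem coeffP_nonneg (hμ : 0 < μ) (hb : 0 ≤ b) (hc₁ : 0 ≤ c₁) :
    0 ≤ coeffP μ L ν ρ₀ ρ₁ ρ₂ b c₁ P := by
  have : 0 ≤ normFactor L c₁ P := zero_le_one.trans (le_max_left _ _)
  unfold coeffP
  positivity

theorem coeffQ_nonneg (hμ : 0 < μ) (hb : 0 ≤ b) (hc₁ : 0 ≤ c₁) :
    0 ≤ coeffQ μ L ν ρ₃ b c₁ P := by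
  have : 0 ≤ normFactor L c₁ P := zero_le_one.trans (le_max_left _ _)
  unfold coeffQ
  positivity

theorem coeffR_pos (hL : 0 < L) (hα : 0 < α) (ha : 0 ≤ a) (hc₁ : 0 ≤ c₁) (hP : P.PosSemidef)
    (h : 0 < c₁ + P 0 0) : 0 < coeffR L α a c₁ P := by
  have h0 : 0 ≤ P 0 0 := hP.diag_nonneg
  have h1 : 0 < c₁ * L / 2 + P 0 0 := by
    rcases hc₁.eq_or_lt with rfl | hc
    · simpa using h
    · positivity
  unfold coeffR
  positivity

theorem hBar_pos (hL : 0 < L) (hα : 0 < α)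
    (hP : IsCertificate μ L α β ν ρ₀ ρ₁ ρ₂ ρ₃ a b c₀ c₁ P) :
    0 < hBar μ L α ν ρ₀ ρ₁ ρ₂ ρ₃ a b c₁ P :=
  Real.sqrt_pos.2 (mul_pos (one_div_pos.2 (sub_pos.2 hP.contraction))
    (div_pos (coeffR_pos hL hα hP.a_nonneg hP.c1_nonneg hP.posSemidef hP.c1_add_pos)
      hP.lyapFactor_pos))

/-- Telescoping of a two-term recursive inequality; at `k = 0` the truncated `k - 1` makes the
initial value its own predecessor. -/
theorem sum_le_of_recursive_le {V s : ℕ → ℝ} {p q r : ℝ} (hp : 0 ≤ p) (hq : 0 ≤ q)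
    (hV : ∀ k, 0 ≤ V k) (h : ∀ k, V (k + 1) ≤ p * V k + q * V (k - 1) + r * s k) (K : ℕ) :
    (1 - (p + q)) * ∑ k ∈ Finset.range (K + 1), V k
      ≤ (1 + q) * V 0 + r * ∑ k ∈ Finset.range K, s k := by
  -- The last two values are kept on the left, where they pay for the next step.
  have key : (1 - (p + q)) * ∑ k ∈ Finset.range (K + 1), V k + (p + q) * V K + q * V (K - 1)
      ≤ (1 + q) * V 0 + r * ∑ k ∈ Finset.range K, s k := by
    induction K with
    | zero =>
      simp only [zero_add, Finset.range_one, Finset.sum_singleton, Finset.range_zero,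
        Finset.sum_empty, zero_tsub]
      linarith
    | succ K ih =>
      rw [Finset.sum_range_succ, Finset.sum_range_succ s, Nat.add_sub_cancel]
      have := h K
      linarith
  have h1 := mul_nonneg (add_nonneg hp hq) (hV K)
  have h2 := mul_nonneg hq (hV (K - 1))
  linarith

section Trajectory

variable [CompleteSpace E] {f : E → ℝ} {z : E}

theorem state_snd (x₀ : E) (w : ℕ → E) (k : ℕ) :
    (state f α β ν x₀ w k).2 = iterate f α β ν x₀ w (k - 1) := by
  cases k <;> rfl

theorem iterate_succ (x₀ : E) (w : ℕ → E) (k : ℕ) :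
    iterate f α β ν x₀ w (k + 1)
      = iterate f α β ν x₀ w k
        - α • (gradient f (iterate f α β ν x₀ w k
            + ν • (iterate f α β ν x₀ w k - iterate f α β ν x₀ w (k - 1))) + w (k + 1))
        + β • (iterate f α β ν x₀ w k - iterate f α β ν x₀ w (k - 1)) := by
  rw [← state_snd]
  rfl

/-- The suboptimality of the averaged iterate is at most `H̄_∞²` times the accumulated squared noise,
up to a constant, divided by the number of iterates. -/
theorem average_suboptimality_le (hf : SmoothStronglyConvex μ L f) (hμ : 0 < μ) (hμL : μ < L)
    (hα : 0 < α) (hz : ∀ x, f z ≤ f x)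
    (hP : IsCertificate μ L α β ν ρ₀ ρ₁ ρ₂ ρ₃ a b c₀ c₁ P) (x₀ : E) :
    ∃ C : ℝ, ∀ (w : ℕ → E) (K : ℕ), ((K : ℝ) + 1) * (f (average f α β ν x₀ w K) - f z)
      ≤ C + hBar μ L α ν ρ₀ ρ₁ ρ₂ ρ₃ a b c₁ P ^ 2 * ∑ k ∈ Finset.range K, ‖w (k + 1)‖ ^ 2 := by
  set p := coeffP μ L ν ρ₀ ρ₁ ρ₂ b c₁ P with hp
  set q := coeffQ μ L ν ρ₃ b c₁ P with hq
  set r := coeffR L α a c₁ P with hr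
  set δ := lyapFactor L c₁ P with hδ
  have hL : 0 < L := hμ.trans hμL
  have hp0 : 0 ≤ p := coeffP_nonneg hμ hP.b_nonneg hP.c1_nonneg
  have hq0 : 0 ≤ q := coeffQ_nonneg hμ hP.b_nonneg hP.c1_nonneg
  have hr0 : 0 ≤ r :=
    (coeffR_pos hL hα hP.a_nonneg hP.c1_nonneg hP.posSemidef hP.c1_add_pos).le
  have hδ0 : 0 < δ := hP.lyapFactor_pos
  have hpq : 0 < 1 - (p + q) := sub_pos.2 hP.contraction
  have hH : hBar μ L α ν ρ₀ ρ₁ ρ₂ ρ₃ a b c₁ P ^ 2 = r / ((1 - (p + q)) * δ) := by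
    rw [hBar, Real.sq_sqrt (mul_nonneg (one_div_nonneg.2 hpq.le) (div_nonneg hr0 hδ0.le)),
      div_mul_div_comm, one_mul]
  refine ⟨(1 + q) * lyap f c₁ P z x₀ x₀ / ((1 - (p + q)) * δ), fun w K => ?_⟩
  set x := iterate f α β ν x₀ w with hx
  set V : ℕ → ℝ := fun k => lyap f c₁ P z (x k) (x (k - 1)) with hV
  have hsum := sum_le_of_recursive_le (V := V) (s := fun k => ‖w (k + 1)‖ ^ 2) hp0 hq0
    (fun k => lyap_nonneg hP.posSemidef hP.c1_nonneg hz _ _)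
    (fun k => by
      simp only [hV, hx, Nat.add_sub_cancel]
      rw [iterate_succ]
      exact lyap_step hf hμ hμL hz hP _ _ _ _) K
  have hsub : δ * ∑ k ∈ Finset.range (K + 1), (f (x k) - f z)
      ≤ ∑ k ∈ Finset.range (K + 1), V k := by
    rw [Finset.mul_sum]
    exact Finset.sum_le_sum fun k _ => lyapFactor_mul_le_lyap hf hL hP.posSemidef hz _ _
  have hK : (0 : ℝ) < (K : ℝ) + 1 := by positivity
  have hjensen : ((K : ℝ) + 1) * (f (average f α β ν x₀ w K) - f z)
      ≤ ∑ k ∈ Finset.range (K + 1), (f (x k) - f z) := by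
    have hcard : ∑ _k ∈ Finset.range (K + 1), ((K : ℝ) + 1)⁻¹ = 1 := by
      rw [Finset.sum_const, Finset.card_range, nsmul_eq_mul, Nat.cast_add_one,
        mul_inv_cancel₀ hK.ne']
    have h := (hf.convexOn hμ).map_sum_le (t := Finset.range (K + 1))
      (w := fun _ => ((K : ℝ) + 1)⁻¹) (p := x) (fun _ _ => (inv_pos.2 hK).le) hcard
      (fun _ _ => Set.mem_univ _)
    rw [← Finset.smul_sum, ← Finset.smul_sum, smul_eq_mul, inv_mul_eq_div, le_div_iff₀ hK] at h
    rw [Finset.sum_sub_distrib, Finset.sum_const, Finset.card_range, nsmul_eq_mul,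
      Nat.cast_add_one, average]
    linarith
  refine hjensen.trans ?_
  rw [hH, div_mul_eq_mul_div, ← add_div, le_div_iff₀ (mul_pos hpq hδ0)]
  calc _ = (1 - (p + q)) * (δ * ∑ k ∈ Finset.range (K + 1), (f (x k) - f z)) := by ring
    _ ≤ (1 - (p + q)) * ∑ k ∈ Finset.range (K + 1), V k := mul_le_mul_of_nonneg_left hsub hpq.le
    _ ≤ _ := hsum

end Trajectory
end Lyapunov

/-! ### Exponential moments of the accumulated noise -/

section Noise

open MeasureTheory

/-- A conditional probability bound against an `m`-measurable weight. -/
theorem setLIntegral_le_of_condExp_le {Ω : Type*} {m m₀ : MeasurableSpace Ω} {Pr : Measure Ω}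
    [IsFiniteMeasure Pr] (hm : m ≤ m₀) {A : Set Ω} (hA : MeasurableSet A) {c : ℝ} (hc : 0 ≤ c)
    (h : ∀ᵐ ω ∂Pr, Pr[A.indicator (fun _ => (1 : ℝ))|m] ω ≤ c)
    {Y : Ω → ℝ≥0∞} (hY : Measurable[m] Y) :
    ∫⁻ ω in A, Y ω ∂Pr ≤ ENNReal.ofReal c * ∫⁻ ω, Y ω ∂Pr := by
  -- The bound integrates over sets of `m`, so it is an inequality of measures on `m`.
  have hle : (Pr.restrict A).trim hm ≤ ENNReal.ofReal c • Pr.trim hm := by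
    refine Measure.le_iff.2 fun B hB => ?_
    rw [Measure.smul_apply, trim_measurableSet_eq hm hB, trim_measurableSet_eq hm hB,
      Measure.restrict_apply (hm B hB), smul_eq_mul, ← ofReal_measureReal,
      ← ofReal_measureReal (μ := Pr) (s := B), ← ENNReal.ofReal_mul hc]
    refine ENNReal.ofReal_le_ofReal ?_
    have hint : Integrable (A.indicator (fun _ => (1 : ℝ))) Pr :=
      (integrable_const 1).indicator hA
    calc Pr.real (B ∩ A) = ∫ ω in B, A.indicator (fun _ => (1 : ℝ)) ω ∂Pr := by
          rw [integral_indicator_const _ hA, measureReal_restrict_apply hA, Set.inter_comm,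
            smul_eq_mul, mul_one]
      _ = ∫ ω in B, (Pr[A.indicator (fun _ => (1 : ℝ))|m]) ω ∂Pr :=
          (setIntegral_condExp hm hint hB).symm
      _ ≤ ∫ _ω in B, c ∂Pr :=
          setIntegral_mono_ae integrable_condExp.integrableOn (integrable_const c).integrableOn h
      _ = c * Pr.real B := by rw [setIntegral_const, smul_eq_mul, mul_comm]
  calc ∫⁻ ω in A, Y ω ∂Pr = ∫⁻ ω, Y ω ∂((Pr.restrict A).trim hm) := (lintegral_trim hm hY).symm
    _ ≤ ∫⁻ ω, Y ω ∂(ENNReal.ofReal c • Pr.trim hm) := lintegral_mono' hle le_rfl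
    _ = _ := by rw [lintegral_smul_measure, lintegral_trim hm hY, smul_eq_mul]

/-- The exponential square moment of a random variable with sub-Gaussian tails, by the layer cake
formula. The bound `2 exp (-s² / (2 σ²))` is used for all `s`, also where it exceeds `1`, so that the
moment is `1 + ∫₀^∞ l exp (l u) · 2 exp (-u) du`. -/
theorem lintegral_exp_sq_le {Ω : Type*} [MeasurableSpace Ω] {ν : Measure Ω} {X : Ω → ℝ}
    (hX : Measurable X) (hX0 : ∀ ω, 0 ≤ X ω) {σ : ℝ} (hσ : 0 < σ)
    (h : ∀ s : ℝ, 0 ≤ s → ν {ω | s ≤ X ω}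
      ≤ ENNReal.ofReal (2 * Real.exp (-(s ^ 2 / (2 * σ ^ 2)))) * ν Set.univ)
    {l : ℝ} (hl0 : 0 ≤ l) (hl1 : l < 1) :
    ∫⁻ ω, ENNReal.ofReal (Real.exp (l / (2 * σ ^ 2) * X ω ^ 2)) ∂ν
      ≤ ENNReal.ofReal ((1 + l) / (1 - l)) * ν Set.univ := by
  set T : Ω → ℝ := fun ω => X ω ^ 2 / (2 * σ ^ 2) with hT
  have hT0 : ∀ ω, 0 ≤ T ω := fun ω => by positivity
  have hTm : Measurable T := (hX.pow_const 2).div_const _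
  have hl1' : 0 < 1 - l := sub_pos.2 hl1
  have hcont : Continuous fun t : ℝ => l * Real.exp (l * t) := by fun_prop
  have hprim : ∀ u : ℝ, ∫ t in (0 : ℝ)..u, l * Real.exp (l * t) = Real.exp (l * u) - 1 := by
    intro u
    have hd : ∀ t ∈ Set.uIcc 0 u,
        HasDerivAt (fun t : ℝ => Real.exp (l * t)) (l * Real.exp (l * t)) t := by
      intro t _
      have := ((hasDerivAt_id t).const_mul l).exp
      simpa [mul_comm] using this
    rw [intervalIntegral.integral_eq_sub_of_hasDerivAt hd (hcont.intervalIntegrable _ _)]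
    simp
  have hlayer := lintegral_comp_eq_lintegral_meas_le_mul ν (f := T)
    (g := fun t => l * Real.exp (l * t)) (Filter.Eventually.of_forall hT0) hTm.aemeasurable
    (fun t _ => hcont.intervalIntegrable _ _)
    (Filter.Eventually.of_forall fun t => by positivity)
  have htail : ∀ t ∈ Set.Ioi (0 : ℝ),
      ν {ω | t ≤ T ω} * ENNReal.ofReal (l * Real.exp (l * t))
        ≤ ENNReal.ofReal (2 * l * Real.exp ((l - 1) * t)) * ν Set.univ := by
    intro t ht
    have ht : 0 < t := ht
    have hset : {ω | t ≤ T ω} = {ω | σ * Real.sqrt (2 * t) ≤ X ω} := by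
      ext ω
      have e : (σ * Real.sqrt (2 * t)) ^ 2 = t * (2 * σ ^ 2) := by
        rw [mul_pow, Real.sq_sqrt (by positivity)]
        ring
      simp only [Set.mem_ofPred_eq, hT]
      rw [le_div_iff₀ (by positivity), ← e,
        pow_le_pow_iff_left₀ (by positivity) (hX0 ω) two_ne_zero]
    have hs := h (σ * Real.sqrt (2 * t)) (by positivity)
    have e : (σ * Real.sqrt (2 * t)) ^ 2 / (2 * σ ^ 2) = t := by
      rw [mul_pow, Real.sq_sqrt (by positivity)]
      field_simp
    rw [e] at hs
    rw [hset]
    calc _ ≤ ENNReal.ofReal (2 * Real.exp (-t)) * ν Set.univ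
          * ENNReal.ofReal (l * Real.exp (l * t)) := by gcongr
      _ = _ := by
          rw [mul_right_comm, ← ENNReal.ofReal_mul (by positivity)]
          congr 2
          rw [show (l - 1) * t = -t + l * t by ring, Real.exp_add]
          ring
  have hexp : ∫⁻ t in Set.Ioi (0 : ℝ), ENNReal.ofReal (2 * l * Real.exp ((l - 1) * t))
      = ENNReal.ofReal (2 * l / (1 - l)) := by
    have hi : IntegrableOn (fun t : ℝ => 2 * l * Real.exp ((l - 1) * t)) (Set.Ioi 0) :=
      (integrableOn_exp_mul_Ioi (by linarith) 0).const_mul _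
    rw [← ofReal_integral_eq_lintegral_ofReal hi
      (Filter.Eventually.of_forall fun t => by positivity), integral_const_mul,
      integral_exp_mul_Ioi (by linarith)]
    congr 1
    have : l - 1 ≠ 0 := by linarith
    rw [mul_zero, Real.exp_zero, ← neg_sub 1 l, neg_div_neg_eq, mul_one_div]
  have hsplit : ∀ ω, ENNReal.ofReal (Real.exp (l / (2 * σ ^ 2) * X ω ^ 2))
      = 1 + ENNReal.ofReal (∫ t in (0 : ℝ)..T ω, l * Real.exp (l * t)) := by
    intro ω
    have hnn : 0 ≤ Real.exp (l * T ω) - 1 :=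
      sub_nonneg.2 (Real.one_le_exp (mul_nonneg hl0 (hT0 ω)))
    rw [hprim, ← ENNReal.ofReal_one, ← ENNReal.ofReal_add zero_le_one hnn, add_sub_cancel, hT,
      div_mul_eq_mul_div, mul_div_assoc]
  calc _ = ν Set.univ + ∫⁻ ω, ENNReal.ofReal (∫ t in (0 : ℝ)..T ω, l * Real.exp (l * t)) ∂ν := by
        simp only [hsplit]
        rw [lintegral_add_left measurable_const, lintegral_one]
    _ ≤ ν Set.univ + ∫⁻ t in Set.Ioi (0 : ℝ),
          ENNReal.ofReal (2 * l * Real.exp ((l - 1) * t)) * ν Set.univ := by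
        rw [hlayer]
        refine add_le_add_right ?_ _
        exact setLIntegral_mono' measurableSet_Ioi htail
    _ = ν Set.univ + ENNReal.ofReal (2 * l / (1 - l)) * ν Set.univ := by
        rw [lintegral_mul_const _ (by fun_prop), hexp]
    _ = _ := by
        have e : (1 + l) / (1 - l) = 1 + 2 * l / (1 - l) := by field_simp; ring
        rw [e, ENNReal.ofReal_add zero_le_one (by positivity), ENNReal.ofReal_one, add_mul, one_mul]

variable {E : Type*} [NormedAddCommGroup E] [InnerProductSpace ℝ E] [CompleteSpace E]
  [MeasurableSpace E] {Ω : Type*} {f : E → ℝ} {μ L α β ν σ : ℝ} {x₀ : E} {w : ℕ → Ω → E}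

theorem iterateSigma_mono : Monotone (iterateSigma f α β ν x₀ w) := fun _ _ h =>
  biSup_mono fun _ hj => Finset.range_mono (Nat.succ_le_succ h) hj

variable [BorelSpace E]

theorem SmoothStronglyConvex.measurable_gradient (hf : SmoothStronglyConvex μ L f) :
    Measurable (gradient f) := by
  have h : LipschitzWith L.toNNReal (gradient f) := LipschitzWith.of_dist_le_mul fun x y => by
    rw [dist_eq_norm, dist_eq_norm]
    exact (hf.lipschitz x y).trans
      (mul_le_mul_of_nonneg_right (Real.le_coe_toNNReal L) (norm_nonneg _))
  exact h.continuous.measurable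

variable [SecondCountableTopology E] {m₀ : MeasurableSpace Ω} {Pr : Measure Ω}

theorem measurable_state (hf : SmoothStronglyConvex μ L f) (hw : ∀ k, Measurable (w (k + 1)))
    (k : ℕ) : Measurable fun ω => state f α β ν x₀ (fun i => w i ω) k := by
  induction k with
  | zero => exact measurable_const
  | succ k ih =>
    have h1 := ih.fst
    have h2 := ih.snd
    have hg := hf.measurable_gradient.comp (h1.add ((h1.sub h2).const_smul ν))
    exact ((h1.sub ((hg.add (hw k)).const_smul α)).add ((h1.sub h2).const_smul β)).prodMk h1

theorem iterateSigma_le (hf : SmoothStronglyConvex μ L f) (hw : ∀ k, Measurable (w (k + 1)))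
    (k : ℕ) : iterateSigma f α β ν x₀ w k ≤ m₀ :=
  iSup₂_le fun j _ => (measurable_state hf hw j).fst.comap_le

/-- Conditioning successively on the past iterates, each noise vector contributes one factor. -/
theorem lintegral_exp_sum_sq_le [IsProbabilityMeasure Pr] (hf : SmoothStronglyConvex μ L f)
    (hσ : 0 < σ) (hw : SubGaussianNoise Pr f α β ν x₀ σ w) {l : ℝ} (hl0 : 0 ≤ l) (hl1 : l < 1)
    (K : ℕ) :
    ∫⁻ ω, ENNReal.ofReal
        (Real.exp (l / (2 * σ ^ 2) * ∑ k ∈ Finset.range K, ‖w (k + 1) ω‖ ^ 2)) ∂Pr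
      ≤ ENNReal.ofReal ((1 + l) / (1 - l)) ^ K := by
  induction K with
  | zero => simp
  | succ K ih =>
    have hFle := iterateSigma_le (α := α) (β := β) (ν := ν) (x₀ := x₀) hf hw.measurable K
    set Y : Ω → ℝ≥0∞ := fun ω => ENNReal.ofReal
      (Real.exp (l / (2 * σ ^ 2) * ∑ k ∈ Finset.range K, ‖w (k + 1) ω‖ ^ 2)) with hY
    have hYF : Measurable[iterateSigma f α β ν x₀ w K] Y := by
      refine ENNReal.measurable_ofReal.comp (Real.measurable_exp.comp
        (Measurable.const_mul (Finset.measurable_sum _ fun k hk => ?_) _))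
      have hk : k + 1 ≤ K := Finset.mem_range.1 hk
      exact (measurable_norm.pow_const 2).comp
        ((hw.adapted k).mono (iterateSigma_mono hk) le_rfl)
    have hYm : Measurable Y := hYF.mono hFle le_rfl
    have hn : Measurable fun ω => ‖w (K + 1) ω‖ := (hw.measurable K).norm
    -- Weighting the measure by the past turns the conditional tail bound into an unconditional one.
    have hstep := lintegral_exp_sq_le (ν := Pr.withDensity Y) hn (fun _ => norm_nonneg _) hσ
      (fun s hs => by
        have hA : MeasurableSet {ω | s ≤ ‖w (K + 1) ω‖} := measurableSet_le measurable_const hn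
        rw [withDensity_apply _ hA, withDensity_apply _ MeasurableSet.univ, Measure.restrict_univ]
        exact setLIntegral_le_of_condExp_le hFle hA (by positivity) (hw.tail K s hs) hYF)
      hl0 hl1
    rw [lintegral_withDensity_eq_lintegral_mul _ hYm (by fun_prop),
      withDensity_apply _ MeasurableSet.univ, Measure.restrict_univ] at hstep
    calc _ = ∫⁻ ω, (Y * fun ω => ENNReal.ofReal
            (Real.exp (l / (2 * σ ^ 2) * ‖w (K + 1) ω‖ ^ 2))) ω ∂Pr := by
          refine lintegral_congr fun ω => ?_
          rw [Pi.mul_apply, hY, ← ENNReal.ofReal_mul (Real.exp_pos _).le, ← Real.exp_add,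
            ← mul_add, Finset.sum_range_succ]
      _ ≤ ENNReal.ofReal ((1 + l) / (1 - l)) * ∫⁻ ω, Y ω ∂Pr := hstep
      _ ≤ ENNReal.ofReal ((1 + l) / (1 - l)) * ENNReal.ofReal ((1 + l) / (1 - l)) ^ K := by
          gcongr
      _ = _ := (pow_succ' _ _).symm

end Noise

/-! ### The large deviation bound -/

section LargeDeviation

open MeasureTheory

/-- Markov's inequality for an exponential, in logarithmic form. -/
theorem log_measure_le_of_exp_moment {Ω : Type*} [MeasurableSpace Ω] {Pr : Measure Ω} {A : Set Ω}
    {S : Ω → ℝ} (hS : Measurable S) {θ v M : ℝ} (hθ : 0 ≤ θ) (hM : 0 < M)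
    (hA : ∀ ω ∈ A, v ≤ S ω) {K : ℕ}
    (h : ∫⁻ ω, ENNReal.ofReal (Real.exp (θ * S ω)) ∂Pr ≤ ENNReal.ofReal M ^ K) :
    ENNReal.log (Pr A) ≤ ((K * Real.log M - θ * v : ℝ) : EReal) := by
  have h1 : Pr A ≤ Pr {ω | ENNReal.ofReal (Real.exp (θ * v))
      ≤ ENNReal.ofReal (Real.exp (θ * S ω))} := by
    refine measure_mono fun ω hω => ENNReal.ofReal_le_ofReal (Real.exp_le_exp.2 ?_)
    exact mul_le_mul_of_nonneg_left (hA ω hω) hθ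
  have hpos : 0 < Real.exp (θ * v) := Real.exp_pos _
  have h2 := meas_ge_le_lintegral_div (μ := Pr)
    (f := fun ω => ENNReal.ofReal (Real.exp (θ * S ω))) (by fun_prop)
    (ENNReal.ofReal_pos.2 hpos).ne' ENNReal.ofReal_ne_top
  have h3 : Pr A ≤ ENNReal.ofReal (Real.exp (K * Real.log M - θ * v)) := by
    refine (h1.trans h2).trans ((ENNReal.div_le_div_right h _).trans_eq ?_)
    rw [Real.exp_sub, ENNReal.ofReal_div_of_pos hpos, Real.exp_nat_mul, Real.exp_log hM,
      ENNReal.ofReal_pow hM.le]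
  calc ENNReal.log (Pr A) ≤ ENNReal.log (ENNReal.ofReal (Real.exp (K * Real.log M - θ * v))) :=
        ENNReal.log_monotone h3
    _ = _ := by rw [ENNReal.log_ofReal_of_pos (Real.exp_pos _), Real.log_exp]

/-- An affine upper bound on the logarithms bounds the exponential decay rate by its slope. -/
theorem limsup_log_div_le {u : ℕ → EReal} {A B : ℝ}
    (h : ∀ K, u K ≤ ((K * A + B : ℝ) : EReal)) :
    Filter.limsup (fun K : ℕ => (((1 / (K : ℝ)) : ℝ) : EReal) * u K) Filter.atTop
      ≤ (A : EReal) := by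
  have hlim : Filter.Tendsto (fun K : ℕ => ((A + B * (1 / (K : ℝ)) : ℝ) : EReal)) Filter.atTop
      (nhds (A : EReal)) := by
    refine (continuous_coe_real_ereal.tendsto _).comp ?_
    simpa using (tendsto_one_div_atTop_nhds_zero_nat.const_mul B).const_add A
  rw [← hlim.limsup_eq]
  refine Filter.limsup_le_limsup ?_
  filter_upwards [Filter.eventually_gt_atTop 0] with K hK
  have hK : (0 : ℝ) < K := Nat.cast_pos.2 hK
  calc (((1 / (K : ℝ)) : ℝ) : EReal) * u K
      ≤ (((1 / (K : ℝ)) : ℝ) : EReal) * ((K * A + B : ℝ) : EReal) :=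
        mul_le_mul_of_nonneg_left (h K) (EReal.coe_nonneg.2 (by positivity))
    _ = _ := by
        rw [← EReal.coe_mul]
        congr 1
        field_simp

end LargeDeviation

end GMM

end

theorem mainTheorem6 {d : ℕ} {Ω : Type*} [MeasurableSpace Ω]
    (Pr : MeasureTheory.Measure Ω) [MeasureTheory.IsProbabilityMeasure Pr]
    (μ L : ℝ) (hμ : 0 < μ) (hμL : μ < L)
    (f : EuclideanSpace ℝ (Fin d) → ℝ) (hf : GMM.SmoothStronglyConvex μ L f)
    (α β ν : ℝ) (hα : 0 < α) (hβ : 0 ≤ β) (hν : 0 ≤ ν)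
    (x₀ : EuclideanSpace ℝ (Fin d))
    (σ : ℝ) (hσ : 0 < σ)
    (w : ℕ → Ω → EuclideanSpace ℝ (Fin d))
    (hw : GMM.SubGaussianNoise Pr f α β ν x₀ σ w)
    (ρ₀ ρ₁ ρ₂ ρ₃ a b c₀ c₁ : ℝ) (P : Matrix (Fin 2) (Fin 2) ℝ)
    (hP : GMM.IsCertificate μ L α β ν ρ₀ ρ₁ ρ₂ ρ₃ a b c₀ c₁ P)
    (t : ℝ) :
    Filter.limsup
      (fun K : ℕ => (((1 / (K : ℝ)) : ℝ) : EReal) *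
        ENNReal.log (Pr {ω | t ≤ f (GMM.average f α β ν x₀ (fun i => w i ω) K) - ⨅ x, f x}))
      Filter.atTop
    ≤ ((-GMM.rate σ (GMM.hBar μ L α ν ρ₀ ρ₁ ρ₂ ρ₃ a b c₁ P) t : ℝ) : EReal) := by
  by_cases ht : 4 * σ ^ 2 * GMM.hBar μ L α ν ρ₀ ρ₁ ρ₂ ρ₃ a b c₁ P ^ 2 ≤ t
  · obtain ⟨z, hz⟩ := hf.exists_minimizer hμ
    obtain ⟨C, hC⟩ := GMM.average_suboptimality_le hf hμ hμL hα hz hP x₀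
    have hmin : ⨅ x, f x = f z :=
      le_antisymm (ciInf_le ⟨f z, Set.forall_mem_range.2 hz⟩ z) (le_ciInf hz)
    have hH : 0 < GMM.hBar μ L α ν ρ₀ ρ₁ ρ₂ ρ₃ a b c₁ P :=
      GMM.hBar_pos (hμ.trans hμL) hα hP
    set H := GMM.hBar μ L α ν ρ₀ ρ₁ ρ₂ ρ₃ a b c₁ P
    have ht0 : 0 < t := lt_of_lt_of_le (by positivity) ht
    -- The maximizer of `l ↦ l t / (2 σ² H²) - log ((1 + l) / (1 - l))` over `[0, 1)`.
    set l := Real.sqrt (1 - 4 * σ ^ 2 * H ^ 2 / t) with hl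
    have hl0 : 0 ≤ l := Real.sqrt_nonneg _
    have hl1 : l < 1 := by
      rw [hl, Real.sqrt_lt' one_pos, one_pow, sub_lt_self_iff]
      positivity
    have hM : 0 < (1 + l) / (1 - l) := div_pos (by linarith) (sub_pos.2 hl1)
    have hrate : -GMM.rate σ H t
        = Real.log ((1 + l) / (1 - l)) - l / (2 * σ ^ 2) * (t / H ^ 2) := by
      rw [GMM.rate, if_pos ht, ← hl]
      field_simp
      ring
    rw [hrate]
    refine GMM.limsup_log_div_le (B := l / (2 * σ ^ 2) * ((C - t) / H ^ 2)) fun K => ?_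
    refine (GMM.log_measure_le_of_exp_moment (v := (((K : ℝ) + 1) * t - C) / H ^ 2) ?_
      (by positivity) hM ?_ (GMM.lintegral_exp_sum_sq_le hf hσ hw hl0 hl1 K)).trans_eq ?_
    · exact Finset.measurable_sum _ fun k _ => (hw.measurable k).norm.pow_const 2
    · intro ω hω
      rw [Set.mem_ofPred_eq, hmin] at hω
      have h1 := hC (fun i => w i ω) K
      have h2 : ((K : ℝ) + 1) * t ≤ ((K : ℝ) + 1)
          * (f (GMM.average f α β ν x₀ (fun i => w i ω) K) - f z) :=
        mul_le_mul_of_nonneg_left hω (by positivity)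
      rw [div_le_iff₀ (by positivity)]
      linarith
    · congr 1
      ring
  · rw [GMM.rate, if_neg ht]
    refine GMM.limsup_log_div_le (B := 0) fun K => ?_
    simpa using MeasureTheory.prob_le_one
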